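/- **Theorem (compression of approximate distances from sources on one face).** There are a decoding function $f$, mapping a finite bit string and two vertex names to a real number, and absolute constants $C,k$ such that the following holds. Let $G=(V,E,\omega)$ be a connected, undirected planar graph on $V=\{0,\dots,n-1\}$ with positive real edge weights, given with a planar embedding, let $d_G$ be its weighted shortest-path distance, let $\mu$ and $M$ be the smallest and the largest distance between two distinct vertices, and let $W=M/\mu$ be the aspect ratio (factors $1+\log W$ are read as $1$ when $n=1$). Let $S\subseteq V$ be a set of sources that lie, not necessarily consecutively, on a single face, and let $0<\varepsilon\le 1$. Say that a bit string $b$ is a $(1+\varepsilon)$-compression of the $S\times T$ distances if $$d_G(s,t)\;\le\;\mu\cdot f(b,s,t)\;\le\;(1+\varepsilon)\,d_G(s,t)\qquad\text{for all } s\in S,\ t\in T,$$ that is, distances are measured in units of the smallest distance (equivalently, the weights are scaled so that $\mu=1$). Then: 1. the $S\times V$ distances have a $(1+\varepsilon)$-compression with at most $$C\,\bigl((|S|/\varepsilon)^k+n\bigr)\,(1+\log W)\,(1+\log n)^k$$ bits, i.e. $\widetilde O(\mathrm{poly}(|S|/\varepsilon)+n)$ bits, where $\widetilde O$ hides the factor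 $1+\log W$ and factors polylogarithmic in $n$; 2. for every set of targets $T\subseteq V$, the $S\times T$ distances have a $(1+\varepsilon)$-compression with at most $$C\,\bigl((|S|/\varepsilon)^k+|T|\bigr)\,(1+\log W)\,(1+\log n)^k$$ bits, i.e. $\widetilde O\bigl((\mathrm{poly}(|S|/\varepsilon)+|T|)\log W\bigr)$ bits. The decoder $f$ does not depend on $G,\omega,n,S,T$ or $\varepsilon$. -/

import Mathlib

namespace PlanarCompression

/-- The combinatorial embedding data of a graph: for each vertex, a cyclic order of the darts
(oriented edges) leaving it. `next d` is the dart that follows `d` in the order around `d.fst`. -/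
structure RotationSystem {V : Type*} (G : SimpleGraph V) where
  next : Equiv.Perm G.Dart
  next_fst : ∀ d : G.Dart, (next d).fst = d.fst
  sameCycle_next : ∀ d d' : G.Dart, d.fst = d'.fst → next.SameCycle d d'

/-- Reversal of darts. -/
def revPerm {V : Type*} (G : SimpleGraph V) : Equiv.Perm G.Dart where
  toFun := SimpleGraph.Dart.symm
  invFun := SimpleGraph.Dart.symm
  left_inv := SimpleGraph.Dart.symm_symm
  right_inv := SimpleGraph.Dart.symm_symm

namespace RotationSystem

variable {V : Type*} {G : SimpleGraph V}

/-- Face tracing: having walked along `d`, continue with the dart that follows the reversal of `d`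
in the order around the head of `d`. The cycles of this permutation are the facial walks. -/
def facePerm (R : RotationSystem G) : Equiv.Perm G.Dart :=
  R.next * revPerm G

/-- The number of faces of a connected graph. Without edges (a single vertex) there are no facial
walks of positive length, but there is one face. -/
noncomputable def numFaces (R : RotationSystem G) : ℕ :=
  max 1 (Nat.card (Quotient (Equiv.Perm.SameCycle.setoid R.facePerm)))

/-- A combinatorial embedding of a finite connected graph is planar if Euler's formula
`|V| - |E| + |F| = 2` holds, i.e. if the surface that it describes is the sphere. -/
def IsPlanar (R : RotationSystem G) : Prop :=
  Nat.card V + R.numFaces = Nat.card G.edgeSet + 2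

/-- All vertices of `S` lie on (the boundary of) a single face. The first alternative is the
one-vertex graph, whose only face has no darts on its boundary. -/
def OnSingleFace (R : RotationSystem G) (S : Finset V) : Prop :=
  Subsingleton V ∨ ∃ d₀ : G.Dart, ∀ s ∈ S, ∃ d : G.Dart, R.facePerm.SameCycle d₀ d ∧ d.fst = s

end RotationSystem

section Distances

variable {V : Type*} (G : SimpleGraph V) (w : Sym2 V → ℝ)

/-- Total weight of a walk. -/
def walkWeight {G : SimpleGraph V} (w : Sym2 V → ℝ) {u v : V} (p : G.Walk u v) : ℝ :=
  (p.edges.map w).sum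

/-- The weighted shortest-path distance. -/
noncomputable def wdist (u v : V) : ℝ :=
  ⨅ p : G.Walk u v, walkWeight w p

/-- The set of distances between distinct vertices. -/
def distances : Set ℝ :=
  {x | ∃ u v : V, u ≠ v ∧ x = wdist G w u v}

/-- The smallest distance between distinct vertices. -/
noncomputable def minDist : ℝ := sInf (distances G w)

/-- The largest distance between distinct vertices. -/
noncomputable def maxDist : ℝ := sSup (distances G w)

/-- The aspect ratio: largest distance over smallest distance. -/
noncomputable def aspectRatio : ℝ := maxDist G w / minDist G w

end Distances

/-- The bit string `b` is an encoding from which the decoder `dec`, given the names of `s ∈ S` and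
`t ∈ T`, returns a `(1 + ε)`-approximation of the distance from `s` to `t`, in units of
the smallest distance of the graph. -/
def IsCompression (dec : List Bool → ℕ → ℕ → ℝ) {n : ℕ} (G : SimpleGraph (Fin n))
    (w : Sym2 (Fin n) → ℝ) (S T : Finset (Fin n)) (ε : ℝ) (b : List Bool) : Prop :=
  ∀ s ∈ S, ∀ t ∈ T,
    wdist G w s t ≤ minDist G w * dec b s t ∧
      minDist G w * dec b s t ≤ (1 + ε) * wdist G w s t

end PlanarCompression

namespace PlanarCompression

section Crossing

open Finset

variable {V : Type*} {G : SimpleGraph V}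

lemma RotationSystem.facePerm_symm (R : RotationSystem G) (d : G.Dart) :
    R.facePerm d.symm = R.next d := by
  simp [facePerm, revPerm]

lemma RotationSystem.fst_facePerm (R : RotationSystem G) (d : G.Dart) :
    (R.facePerm d).fst = d.snd := by
  rw [facePerm, Equiv.Perm.mul_apply, R.next_fst]; rfl

/-- A function on darts that is invariant under rotation and reversal is constant. -/
lemma RotationSystem.eq_of_invariant (R : RotationSystem G) (hG : G.Connected) {α : Type*}
    (A : G.Dart → α) (hn : ∀ d, A (R.next d) = A d) (hs : ∀ d : G.Dart, A d.symm = A d)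
    (d d' : G.Dart) : A d = A d' := by
  have hc : ∀ d d' : G.Dart, d.fst = d'.fst → A d = A d' := by
    intro d d' h
    obtain ⟨k, hk⟩ := R.sameCycle_next d d' h
    have hz : ∀ k : ℤ, ∀ d, A ((R.next ^ k) d) = A d := by
      intro k
      induction k using Int.induction_on with
      | zero => simp
      | succ k ih => intro d; rw [add_comm, zpow_add, zpow_one, Equiv.Perm.mul_apply, hn, ih]
      | pred k ih =>
        intro d
        rw [← hn, ← Equiv.Perm.mul_apply, ← zpow_one_add]
        have : (1 + (-(k : ℤ) - 1)) = -k := by ring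
        rw [this, ih]
    rw [← hk, hz]
  have hw : ∀ {u v : V} (p : G.Walk u v) (d d' : G.Dart), d.fst = u → d'.fst = v → A d = A d' := by
    intro u v p
    induction p with
    | nil => intro d d' h h'; exact hc d d' (h.trans h'.symm)
    | @cons u x v hux p ih =>
      intro d d' h h'
      let e : G.Dart := ⟨(u, x), hux⟩
      rw [hc d e h, ← hs e]
      exact ih _ _ rfl h'
  obtain ⟨p⟩ := hG.preconnected d.fst d'.fst
  exact hw p d d' rfl rfl

/-- The faces of an embedding that have a dart. -/
abbrev RotationSystem.Face (R : RotationSystem G) :=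
  Quotient (Equiv.Perm.SameCycle.setoid R.facePerm)

lemma RotationSystem.mk_facePerm (R : RotationSystem G) (d : G.Dart) :
    (Quotient.mk _ (R.facePerm d) : R.Face) = Quotient.mk _ d :=
  Quotient.sound (Equiv.Perm.SameCycle.symm ⟨1, by simp⟩)

variable [DecidableEq V]

/-- The number of passages of a list of darts through a dart, modulo 2. -/
def multiplicity (l : List G.Dart) (d : G.Dart) : ZMod 2 := l.count d

lemma sum_boundary_walk {u v : V} (p : G.Walk u v) (x : V) :
    (p.darts.map fun d => (if d.fst = x then 1 else 0) + (if d.snd = x then 1 else 0)).sum =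
      ((if u = x then 1 else 0) + (if v = x then 1 else 0) : ZMod 2) := by
  induction p with
  | nil => simp [CharTwo.add_self_eq_zero]
  | @cons u y v h p ih =>
    rw [SimpleGraph.Walk.darts_cons, List.map_cons, List.sum_cons, ih]
    have := CharTwo.add_self_eq_zero (if y = x then (1 : ZMod 2) else 0)
    linear_combination this

/-- The facial walk with `m` darts that begins with `d`. -/
def RotationSystem.facialDarts (R : RotationSystem G) (d : G.Dart) (m : ℕ) : List G.Dart :=
  (List.range m).map fun k => (R.facePerm ^ k) d

lemma RotationSystem.sum_boundary_facialDarts (R : RotationSystem G) (d : G.Dart) (m : ℕ) (x : V) :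
    ((R.facialDarts d m).map fun d =>
      (if d.fst = x then 1 else 0) + (if d.snd = x then 1 else 0)).sum =
      ((if d.fst = x then 1 else 0) +
        (if ((R.facePerm ^ m) d).fst = x then 1 else 0) : ZMod 2) := by
  induction m with
  | zero => simp [facialDarts, CharTwo.add_self_eq_zero]
  | succ m ih =>
    rw [facialDarts] at ih ⊢
    rw [List.range_succ, List.map_append, List.map_append, List.sum_append, ih]
    simp only [List.map_cons, List.map_nil, List.sum_cons, List.sum_nil, add_zero]
    rw [← R.fst_facePerm, ← Equiv.Perm.mul_apply, ← pow_succ']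
    have := CharTwo.add_self_eq_zero
      (if ((R.facePerm ^ m) d).fst = x then (1 : ZMod 2) else 0)
    linear_combination this

lemma RotationSystem.multiplicity_facialDarts_facePerm (R : RotationSystem G) (d d' : G.Dart)
    (m : ℕ) (h₀ : R.facePerm d' ≠ d) (h₁ : R.facePerm d' ≠ (R.facePerm ^ m) d) :
    multiplicity (R.facialDarts d m) (R.facePerm d') = multiplicity (R.facialDarts d m) d' := by
  have key : ∀ m, multiplicity (R.facialDarts d m) (R.facePerm d') +
      (if (R.facePerm ^ m) d = R.facePerm d' then 1 else 0) =
      multiplicity (R.facialDarts d m) d' := by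
    intro m
    induction m with
    | zero => simp [facialDarts, multiplicity, h₀.symm]
    | succ m ih =>
      simp only [multiplicity, facialDarts] at ih ⊢
      rw [List.range_succ, List.map_append, List.count_append, List.count_append, Nat.cast_add,
        Nat.cast_add, ← ih]
      simp only [List.map_cons, List.map_nil, List.count_singleton]
      rw [pow_succ', Equiv.Perm.mul_apply]
      simp only [EmbeddingLike.apply_eq_iff_eq, beq_iff_eq]
      push_cast
      ring
  rw [← key m, if_neg h₁.symm, add_zero]

variable [Fintype V] [DecidableRel G.Adj]

lemma sum_dart_edge_eq {M : Type*} [AddCommMonoid M] (f : G.Dart → M) (d : G.Dart) :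
    ∑ d' with d'.edge = d.edge, f d' = f d + f d.symm := by
  rw [SimpleGraph.Dart.edge_fiber, sum_pair (SimpleGraph.Dart.symm_ne d).symm]

/-- The vertex-edge incidence matrix modulo 2. -/
def incidence (G : SimpleGraph V) [DecidableRel G.Adj] : Matrix V G.edgeSet (ZMod 2) :=
  fun v e => ∑ d : G.Dart, if d.fst = v ∧ d.edge = e.1 then 1 else 0

lemma incidence_mulVec (z : G.edgeSet → ZMod 2) (v : V) :
    (incidence G).mulVec z v = ∑ d : G.Dart with d.fst = v, z ⟨d.edge, d.edge_mem⟩ := by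
  simp only [Matrix.mulVec, dotProduct, incidence, sum_mul]
  rw [sum_comm, sum_filter]
  refine sum_congr rfl fun d _ => ?_
  rw [sum_eq_single ⟨d.edge, d.edge_mem⟩]
  · by_cases h : d.fst = v <;> simp [h]
  · intro e _ he
    rw [if_neg, zero_mul]
    rintro ⟨-, h⟩
    exact he (Subtype.ext h.symm)
  · simp

lemma incidence_transpose_mulVec (f : V → ZMod 2) (d : G.Dart) :
    (incidence G).transpose.mulVec f ⟨d.edge, d.edge_mem⟩ = f d.fst + f d.snd := by
  simp only [Matrix.mulVec, dotProduct, incidence, Matrix.transpose_apply, sum_mul]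
  rw [sum_comm]
  refine Eq.trans ?_ (sum_dart_edge_eq (fun d => f d.fst) d)
  rw [sum_filter]
  refine sum_congr rfl fun d' _ => ?_
  rw [sum_eq_single d'.fst]
  · by_cases h : d'.edge = d.edge <;> simp [h]
  · intro v _ hv
    rw [if_neg, zero_mul]
    rintro ⟨h, -⟩
    exact hv h.symm
  · simp

lemma card_le_rank_incidence (hG : G.Connected) : Fintype.card V ≤ (incidence G).rank + 1 := by
  rw [← Matrix.rank_transpose]
  have h := LinearMap.finrank_range_add_finrank_ker (incidence G).transpose.mulVecLin
  rw [Module.finrank_fintype_fun_eq_card] at h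
  have hker : LinearMap.ker (incidence G).transpose.mulVecLin ≤
      Submodule.span (ZMod 2) {fun _ => 1} := by
    intro f hf
    rw [LinearMap.mem_ker, Matrix.mulVecLin_apply] at hf
    have hadj : ∀ u v, G.Adj u v → f u = f v := by
      intro u v huv
      have := incidence_transpose_mulVec f ⟨(u, v), huv⟩
      rw [hf] at this
      exact CharTwo.add_eq_zero.1 this.symm
    obtain ⟨v₀⟩ := hG.nonempty
    refine Submodule.mem_span_singleton.2 ⟨f v₀, ?_⟩
    ext v
    obtain ⟨p⟩ := hG.preconnected v₀ v
    have : f v₀ = f v := by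
      induction p with
      | nil => rfl
      | cons h p ih => exact (hadj _ _ h).trans ih
    simp [this]
  have h1 : Module.finrank (ZMod 2) (LinearMap.ker (incidence G).transpose.mulVecLin) ≤ 1 :=
    (Submodule.finrank_mono hker).trans ((finrank_span_le_card _).trans (by simp))
  rw [Matrix.rank]
  omega

/-- The coboundary of a face colouring modulo 2: an edge gets the sum of its two sides. -/
noncomputable def RotationSystem.coboundary (R : RotationSystem G) :
    (R.Face → ZMod 2) →ₗ[ZMod 2] (G.edgeSet → ZMod 2) where
  toFun A e := ∑ d : G.Dart with d.edge = e.1, A (Quotient.mk _ d)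
  map_add' A B := by ext e; simp [sum_add_distrib]
  map_smul' c A := by ext e; simp [mul_sum]

lemma RotationSystem.coboundary_apply (R : RotationSystem G) (A : R.Face → ZMod 2) (d : G.Dart) :
    R.coboundary A ⟨d.edge, d.edge_mem⟩ = A (Quotient.mk _ d) + A (Quotient.mk _ d.symm) :=
  sum_dart_edge_eq (fun d => A (Quotient.mk _ d)) d

lemma RotationSystem.incidence_coboundary (R : RotationSystem G) (A : R.Face → ZMod 2) :
    (incidence G).mulVec (R.coboundary A) = 0 := by
  ext v
  rw [incidence_mulVec]
  simp only [coboundary_apply]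
  rw [sum_add_distrib]
  have : ∑ d : G.Dart with d.fst = v, A (Quotient.mk _ d.symm) =
      ∑ d : G.Dart with d.fst = v, A (Quotient.mk _ d) := by
    refine sum_equiv R.next (fun d => ?_) fun d _ => ?_
    · simp [R.next_fst]
    · rw [← R.facePerm_symm, R.mk_facePerm]
  rw [this, CharTwo.add_self_eq_zero]
  rfl

/-- In a planar embedding every cycle modulo 2 is the coboundary of a face colouring. -/
theorem RotationSystem.exists_coboundary_eq (R : RotationSystem G) (hG : G.Connected)
    (hR : R.IsPlanar) (hd : Nonempty G.Dart) (z : G.edgeSet → ZMod 2)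
    (hz : (incidence G).mulVec z = 0) : ∃ A, R.coboundary A = z := by
  classical
  have hface : R.numFaces = Fintype.card R.Face := by
    obtain ⟨d⟩ := hd
    have : 0 < Fintype.card R.Face := Fintype.card_pos_iff.2 ⟨Quotient.mk _ d⟩
    rw [numFaces, Nat.card_eq_fintype_card]
    exact max_eq_right this
  rw [IsPlanar, hface, Nat.card_eq_fintype_card, Nat.card_eq_fintype_card] at hR
  have hV := card_le_rank_incidence hG
  have hker : LinearMap.ker R.coboundary ≤ Submodule.span (ZMod 2) {fun _ => 1} := by
    intro A hA
    rw [LinearMap.mem_ker] at hA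
    have hs : ∀ d : G.Dart, A (Quotient.mk _ d.symm) = A (Quotient.mk _ d) := by
      intro d
      have := R.coboundary_apply A d
      rw [hA] at this
      exact (CharTwo.add_eq_zero.1 this.symm).symm
    obtain ⟨d₀⟩ := hd
    refine Submodule.mem_span_singleton.2 ⟨A (Quotient.mk _ d₀), ?_⟩
    ext F
    obtain ⟨d, rfl⟩ := Quotient.exists_rep F
    have := R.eq_of_invariant hG (fun d => A (Quotient.mk _ d))
      (fun d => by rw [← R.facePerm_symm, R.mk_facePerm, hs]) hs d₀ d
    simpa using this
  have h1 : Module.finrank (ZMod 2) (LinearMap.ker R.coboundary) ≤ 1 :=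
    (Submodule.finrank_mono hker).trans ((finrank_span_le_card _).trans (by simp))
  have h2 := LinearMap.finrank_range_add_finrank_ker R.coboundary
  have h3 := LinearMap.finrank_range_add_finrank_ker (incidence G).mulVecLin
  rw [Module.finrank_fintype_fun_eq_card] at h2 h3
  rw [Matrix.rank] at hV
  have hle : LinearMap.range R.coboundary ≤ LinearMap.ker (incidence G).mulVecLin := by
    rintro _ ⟨A, rfl⟩
    exact R.incidence_coboundary A
  have heq := Submodule.eq_of_le_of_finrank_le hle (by omega)
  have : z ∈ LinearMap.range R.coboundary := by
    rw [heq]; exact hz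
  exact this

lemma sum_multiplicity (l : List G.Dart) (v : V) :
    ∑ d : G.Dart with d.fst = v, (multiplicity l d + multiplicity l d.symm) =
      (l.map fun d => (if d.fst = v then 1 else 0) + (if d.snd = v then 1 else 0)).sum := by
  induction l with
  | nil => simp [multiplicity]
  | cons a l ih =>
    rw [List.map_cons, List.sum_cons, ← ih]
    simp only [multiplicity, List.count_cons, Nat.cast_add, sum_add_distrib]
    have h1 : ∑ d : G.Dart with d.fst = v, (((if a == d then 1 else 0 : ℕ)) : ZMod 2) =
        if a.fst = v then 1 else 0 := by
      rw [sum_filter, sum_eq_single a]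
      · simp
      · intro b _ hb; simp [hb.symm]
      · simp
    have h2 : ∑ d : G.Dart with d.fst = v, (((if a == d.symm then 1 else 0 : ℕ)) : ZMod 2) =
        if a.snd = v then 1 else 0 := by
      rw [sum_filter, sum_eq_single a.symm]
      · simp
      · intro b _ hb
        have : a ≠ b.symm := fun h => hb (by simp [h])
        simp [this]
      · simp
    rw [h1, h2]; ring

/-- Two walks that join alternating vertices of a face of a planar embedding meet. -/
theorem RotationSystem.exists_mem_support_of_alternating (R : RotationSystem G)
    (hG : G.Connected) (hR : R.IsPlanar) (d : G.Dart) {i m l : ℕ} (him : i < m) (hml : m < l)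
    (hinj : ∀ a ≤ l, ∀ b ≤ l, (R.facePerm ^ a) d = (R.facePerm ^ b) d → a = b)
    {a b a' b' : V} (ha : d.fst = a) (hb : ((R.facePerm ^ m) d).fst = b)
    (ha' : ((R.facePerm ^ i) d).fst = a') (hb' : ((R.facePerm ^ l) d).fst = b')
    (p : G.Walk a b) (q : G.Walk a' b') : ∃ x, x ∈ p.support ∧ x ∈ q.support := by
  by_contra! hdisj
  subst ha hb ha' hb'
  let χ := multiplicity (R.facialDarts d m)
  let c := multiplicity p.darts
  have hrec : ∀ d' : G.Dart, d'.fst ∉ p.support → c d' = 0 ∧ c d'.symm = 0 := by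
    intro d' hd'
    constructor
    · have : d' ∉ p.darts := fun h => hd' (p.dart_fst_mem_support_of_mem_darts h)
      simp [c, multiplicity, List.count_eq_zero.2 this]
    · have : d'.symm ∉ p.darts := fun h => hd' (p.dart_snd_mem_support_of_mem_darts h)
      simp [c, multiplicity, List.count_eq_zero.2 this]
  let z : G.edgeSet → ZMod 2 := fun e => ∑ d' : G.Dart with d'.edge = e.1, (c d' + χ d')
  have hzd : ∀ d' : G.Dart, z ⟨d'.edge, d'.edge_mem⟩ =
      (c d' + c d'.symm) + (χ d' + χ d'.symm) := by
    intro d'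
    refine (sum_dart_edge_eq (fun d' => c d' + χ d') d').trans ?_
    ring
  have hz : (incidence G).mulVec z = 0 := by
    ext v
    rw [incidence_mulVec]
    simp only [hzd]
    rw [sum_add_distrib, sum_multiplicity, sum_multiplicity, sum_boundary_walk,
      R.sum_boundary_facialDarts, CharTwo.add_self_eq_zero]
    rfl
  obtain ⟨A, hA⟩ := R.exists_coboundary_eq hG hR ⟨d⟩ z hz
  let B : G.Dart → ZMod 2 := fun d' => A (Quotient.mk _ d') + χ d'
  have hsymm : ∀ d' : G.Dart, d'.fst ∉ p.support → B d'.symm = B d' := by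
    intro d' hd'
    have h := hzd d'
    rw [← hA, R.coboundary_apply, (hrec d' hd').1, (hrec d' hd').2] at h
    have h0 : B d' + B d'.symm = 0 := by
      have h2 := CharTwo.add_self_eq_zero (χ d' + χ d'.symm)
      simp only [B]
      linear_combination h + h2
    exact (CharTwo.add_eq_zero.1 h0).symm
  have hnext : ∀ d' : G.Dart, d'.fst ∉ p.support → B (R.next d') = B d' := by
    intro d' hd'
    rw [← hsymm d' hd', ← R.facePerm_symm]
    simp only [B]
    rw [R.mk_facePerm]
    congr 1
    apply R.multiplicity_facialDarts_facePerm
    · intro h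
      apply hd'
      rw [R.facePerm_symm] at h
      rw [← R.next_fst d', congrArg (fun d : G.Dart => d.fst) h]
      exact p.start_mem_support
    · intro h
      apply hd'
      rw [R.facePerm_symm] at h
      rw [← R.next_fst d', congrArg (fun d : G.Dart => d.fst) h]
      exact p.end_mem_support
  have hpow : ∀ k : ℕ, ∀ d' : G.Dart, d'.fst ∉ p.support → B ((R.next ^ k) d') = B d' ∧
      ((R.next ^ k) d').fst = d'.fst := by
    intro k
    induction k with
    | zero => simp
    | succ k ih =>
      intro d' hd'
      obtain ⟨h1, h2⟩ := ih d' hd'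
      rw [pow_succ', Equiv.Perm.mul_apply, R.next_fst, hnext _ (by rwa [h2])]
      exact ⟨h1, h2⟩
  have hvert : ∀ d₁ d₂ : G.Dart, d₁.fst = d₂.fst → d₁.fst ∉ p.support → B d₁ = B d₂ := by
    intro d₁ d₂ h h'
    obtain ⟨k, -, -, hk⟩ := (R.sameCycle_next d₁ d₂ h).exists_pow_eq
    rw [← hk, (hpow k d₁ h').1]
  have hwalk : ∀ {u v : V} (q : G.Walk u v), (∀ x ∈ q.support, x ∉ p.support) →
      ∀ d₁ d₂ : G.Dart, d₁.fst = u → d₂.fst = v → B d₁ = B d₂ := by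
    intro u v q
    induction q with
    | nil =>
      intro hq d₁ d₂ h₁ h₂
      exact hvert _ _ (h₁.trans h₂.symm) (hq _ (by simp [h₁]))
    | @cons u x v hux q ih =>
      intro hq d₁ d₂ h₁ h₂
      let e : G.Dart := ⟨(u, x), hux⟩
      have hu : u ∉ p.support := hq u (by simp)
      rw [hvert d₁ e h₁ (by rwa [h₁]), ← hsymm e hu]
      exact ih (fun y hy => hq y (by simp [hy])) _ _ rfl h₂
  have hB := hwalk q (fun x hx hx' => hdisj x hx' hx) _ _ rfl rfl
  have hface : ∀ k : ℕ, (Quotient.mk _ ((R.facePerm ^ k) d) : R.Face) = Quotient.mk _ d := by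
    intro k
    induction k with
    | zero => simp
    | succ k ih => rw [pow_succ', Equiv.Perm.mul_apply, R.mk_facePerm, ih]
  have hnodup : (R.facialDarts d m).Nodup := by
    rw [facialDarts, List.nodup_map_iff_inj_on List.nodup_range]
    intro x hx y hy h
    rw [List.mem_range] at hx hy
    exact hinj x (by omega) y (by omega) h
  have h1 : χ ((R.facePerm ^ i) d) = 1 := by
    have : (R.facePerm ^ i) d ∈ R.facialDarts d m :=
      List.mem_map.2 ⟨i, List.mem_range.2 him, rfl⟩
    simp [χ, multiplicity, List.count_eq_one_of_mem hnodup this]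
  have h2 : χ ((R.facePerm ^ l) d) = 0 := by
    have : (R.facePerm ^ l) d ∉ R.facialDarts d m := by
      intro h
      obtain ⟨k, hk, h⟩ := List.mem_map.1 h
      rw [List.mem_range] at hk
      have := hinj k (by omega) l le_rfl h
      omega
    simp [χ, multiplicity, List.count_eq_zero.2 this]
  simp only [B, hface, h1, h2] at hB
  simp at hB

end Crossing

section FacePositions

variable {V : Type*} [Fintype V] {G : SimpleGraph V}

/-- Any two walks with the given pairs of ends have a common vertex. -/
def WalksMeet (G : SimpleGraph V) (a b a' b' : V) : Prop :=
  ∀ (p : G.Walk a b) (q : G.Walk a' b'), ∃ x, x ∈ p.support ∧ x ∈ q.support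

omit [Fintype V] in
lemma WalksMeet.swap_right {a b a' b' : V} (h : WalksMeet G a b a' b') : WalksMeet G a b b' a' := by
  intro p q
  obtain ⟨x, hx, hx'⟩ := h p q.reverse
  exact ⟨x, hx, by simpa using hx'⟩

lemma RotationSystem.walksMeet_of_onSingleFace (R : RotationSystem G) (hG : G.Connected)
    (hR : R.IsPlanar) {S : Finset V} (hS : R.OnSingleFace S) {p s₁ s₂ s₃ : V} (hp : p ∈ S)
    (h₁ : s₁ ∈ S) (h₂ : s₂ ∈ S) (h₃ : s₃ ∈ S) (hp₁ : s₁ ≠ p) (hp₂ : s₂ ≠ p) (hp₃ : s₃ ≠ p)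
    (h₁₂ : s₁ ≠ s₂) (h₁₃ : s₁ ≠ s₃) (h₂₃ : s₂ ≠ s₃) :
    WalksMeet G p s₁ s₂ s₃ ∨ WalksMeet G p s₂ s₁ s₃ ∨ WalksMeet G p s₃ s₁ s₂ := by
  classical
  rcases hS with hS | ⟨d₀, hd₀⟩
  · exact absurd (Subsingleton.elim _ _) hp₁
  obtain ⟨d, hd, rfl⟩ := hd₀ p hp
  have hex : ∀ s ∈ S, ∃ i : ℕ, ((R.facePerm ^ i) d).fst = s := by
    intro s hs
    obtain ⟨d', hd', rfl⟩ := hd₀ s hs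
    obtain ⟨i, -, -, hi⟩ := (hd.symm.trans hd').exists_pow_eq
    exact ⟨i, by rw [hi]⟩
  have hpos : ∀ s ∈ S, ∃ i : ℕ, ((R.facePerm ^ i) d).fst = s ∧
      ∀ a ≤ i, ∀ b ≤ i, (R.facePerm ^ a) d = (R.facePerm ^ b) d → a = b := by
    intro s hs
    refine ⟨Nat.find (hex s hs), Nat.find_spec (hex s hs), ?_⟩
    have key : ∀ a b, a < b → b ≤ Nat.find (hex s hs) →
        (R.facePerm ^ a) d ≠ (R.facePerm ^ b) d := by
      intro a b hab hb h
      refine Nat.find_min (hex s hs) (m := Nat.find (hex s hs) - b + a) (by omega) ?_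
      rw [pow_add, Equiv.Perm.mul_apply, h, ← Equiv.Perm.mul_apply, ← pow_add,
        Nat.sub_add_cancel hb]
      exact Nat.find_spec (hex s hs)
    intro a ha b hb h
    rcases lt_trichotomy a b with hab | hab | hab
    · exact absurd h (key a b hab hb)
    · exact hab
    · exact absurd h.symm (key b a hab ha)
  obtain ⟨i₁, hi₁, hj₁⟩ := hpos s₁ h₁
  obtain ⟨i₂, hi₂, hj₂⟩ := hpos s₂ h₂
  obtain ⟨i₃, hi₃, hj₃⟩ := hpos s₃ h₃
  have core : ∀ {i m l : ℕ} {a b c : V}, i < m → m < l →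
      (∀ a ≤ l, ∀ b ≤ l, (R.facePerm ^ a) d = (R.facePerm ^ b) d → a = b) →
      ((R.facePerm ^ i) d).fst = a → ((R.facePerm ^ m) d).fst = b →
      ((R.facePerm ^ l) d).fst = c → WalksMeet G d.fst b a c :=
    fun him hml hinj ha hb hc p q =>
      R.exists_mem_support_of_alternating hG hR d him hml hinj rfl hb ha hc p q
  have n₁₂ : i₁ ≠ i₂ := by rintro rfl; exact h₁₂ (hi₁.symm.trans hi₂)
  have n₁₃ : i₁ ≠ i₃ := by rintro rfl; exact h₁₃ (hi₁.symm.trans hi₃)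
  have n₂₃ : i₂ ≠ i₃ := by rintro rfl; exact h₂₃ (hi₂.symm.trans hi₃)
  rcases n₁₂.lt_or_gt with h | h <;> rcases n₁₃.lt_or_gt with h' | h' <;>
    rcases n₂₃.lt_or_gt with h'' | h''
  · exact Or.inr (Or.inl (core h h'' hj₃ hi₁ hi₂ hi₃))
  · exact Or.inr (Or.inr (core h' h'' hj₂ hi₁ hi₃ hi₂))
  · omega
  · exact Or.inl (core h' h hj₂ hi₃ hi₁ hi₂).swap_right
  · exact Or.inl (core h h' hj₃ hi₂ hi₁ hi₃)
  · omega
  · exact Or.inr (Or.inr (core h'' h' hj₁ hi₂ hi₃ hi₁).swap_right)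
  · exact Or.inr (Or.inl (core h'' h hj₁ hi₃ hi₂ hi₁).swap_right)

end FacePositions

section Metric

variable {V : Type*} {G : SimpleGraph V} {w : Sym2 V → ℝ}

lemma walkWeight_append {u v x : V} (p : G.Walk u v) (q : G.Walk v x) :
    walkWeight w (p.append q) = walkWeight w p + walkWeight w q := by
  simp [walkWeight]

lemma walkWeight_reverse {u v : V} (p : G.Walk u v) :
    walkWeight w p.reverse = walkWeight w p := by
  simp [walkWeight]

lemma walkWeight_nonneg (hw : ∀ e ∈ G.edgeSet, 0 < w e) {u v : V} (p : G.Walk u v) :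
    0 ≤ walkWeight w p := by
  refine List.sum_nonneg fun x hx => ?_
  obtain ⟨e, he, rfl⟩ := List.mem_map.1 hx
  exact (hw e (p.edges_subset_edgeSet he)).le

lemma wdist_le (hw : ∀ e ∈ G.edgeSet, 0 < w e) {u v : V} (p : G.Walk u v) :
    wdist G w u v ≤ walkWeight w p :=
  ciInf_le ⟨0, by rintro _ ⟨q, rfl⟩; exact walkWeight_nonneg hw q⟩ p

variable [Fintype V]

lemma exists_walkWeight_eq_wdist (hG : G.Connected) (hw : ∀ e ∈ G.edgeSet, 0 < w e) (u v : V) :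
    ∃ p : G.Walk u v, walkWeight w p = wdist G w u v := by
  classical
  have hbp : ∀ p : G.Walk u v, walkWeight w p.bypass ≤ walkWeight w p := by
    intro p
    refine (p.edges_bypass_sublist_edges.map w).sum_le_sum fun x hx => ?_
    obtain ⟨e, he, rfl⟩ := List.mem_map.1 hx
    exact (hw e (p.edges_subset_edgeSet he)).le
  obtain ⟨p₀⟩ := hG.preconnected u v
  have : Nonempty (G.Path u v) := ⟨⟨p₀.bypass, p₀.bypass_isPath⟩⟩
  obtain ⟨p, hp⟩ := Finite.exists_min fun p : G.Path u v => walkWeight w p.1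
  refine ⟨p.1, le_antisymm ?_ (wdist_le hw _)⟩
  have : Nonempty (G.Walk u v) := ⟨p₀⟩
  exact le_ciInf fun q => (hp ⟨q.bypass, q.bypass_isPath⟩).trans (hbp q)

omit [Fintype V] in
lemma wdist_self (hw : ∀ e ∈ G.edgeSet, 0 < w e) (u : V) : wdist G w u u = 0 := by
  refine le_antisymm ((wdist_le hw SimpleGraph.Walk.nil).trans (by simp [walkWeight])) ?_
  have : Nonempty (G.Walk u u) := ⟨SimpleGraph.Walk.nil⟩
  exact le_ciInf fun q => walkWeight_nonneg hw q

lemma wdist_comm (hG : G.Connected) (hw : ∀ e ∈ G.edgeSet, 0 < w e) (u v : V) :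
    wdist G w u v = wdist G w v u := by
  have : ∀ u v, wdist G w u v ≤ wdist G w v u := by
    intro u v
    obtain ⟨p, hp⟩ := exists_walkWeight_eq_wdist hG hw v u
    rw [← hp, ← walkWeight_reverse]
    exact wdist_le hw _
  exact le_antisymm (this u v) (this v u)

lemma wdist_triangle (hG : G.Connected) (hw : ∀ e ∈ G.edgeSet, 0 < w e) (u v x : V) :
    wdist G w u x ≤ wdist G w u v + wdist G w v x := by
  obtain ⟨p, hp⟩ := exists_walkWeight_eq_wdist hG hw u v
  obtain ⟨q, hq⟩ := exists_walkWeight_eq_wdist hG hw v x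
  rw [← hp, ← hq, ← walkWeight_append]
  exact wdist_le hw _

lemma wdist_pos (hG : G.Connected) (hw : ∀ e ∈ G.edgeSet, 0 < w e) {u v : V} (huv : u ≠ v) :
    0 < wdist G w u v := by
  obtain ⟨p, hp⟩ := exists_walkWeight_eq_wdist hG hw u v
  rw [← hp]
  cases p with
  | nil => exact absurd rfl huv
  | @cons _ x _ h p =>
    have h1 := hw s(u, x) h
    have h2 := walkWeight_nonneg hw p
    simp only [walkWeight, SimpleGraph.Walk.edges_cons, List.map_cons, List.sum_cons] at h2 ⊢
    linarith

omit [Fintype V] in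
lemma wdist_add_le_of_mem_support (hw : ∀ e ∈ G.edgeSet, 0 < w e) {u v x : V} {p : G.Walk u v}
    (hp : walkWeight w p = wdist G w u v) (hx : x ∈ p.support) :
    wdist G w u x + wdist G w x v ≤ wdist G w u v := by
  classical
  rw [← hp, ← p.take_spec hx, walkWeight_append]
  exact add_le_add (wdist_le hw _) (wdist_le hw _)

lemma finite_distances : (distances G w).Finite := by
  refine (Set.finite_range fun x : V × V => wdist G w x.1 x.2).subset ?_
  rintro _ ⟨u, v, -, rfl⟩
  exact ⟨(u, v), rfl⟩

lemma minDist_le_wdist {u v : V} (huv : u ≠ v) : minDist G w ≤ wdist G w u v :=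
  csInf_le finite_distances.bddBelow ⟨u, v, huv, rfl⟩

lemma wdist_le_maxDist {u v : V} (huv : u ≠ v) : wdist G w u v ≤ maxDist G w :=
  le_csSup finite_distances.bddAbove ⟨u, v, huv, rfl⟩

lemma minDist_pos [Nontrivial V] (hG : G.Connected) (hw : ∀ e ∈ G.edgeSet, 0 < w e) :
    0 < minDist G w := by
  obtain ⟨u, v, huv⟩ := exists_pair_ne V
  obtain ⟨x, y, hxy, h⟩ := Set.Nonempty.csInf_mem
    (⟨_, u, v, huv, rfl⟩ : (distances G w).Nonempty) finite_distances
  rw [minDist, h]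
  exact wdist_pos hG hw hxy

/-- Exchange inequality for crossing pairs of shortest paths. -/
lemma WalksMeet.exists_exchange {a b a' b' : V} (h : WalksMeet G a b a' b') (hG : G.Connected)
    (hw : ∀ e ∈ G.edgeSet, 0 < w e) (t t' : V) :
    ∃ e e', (e = a ∨ e = b) ∧ (e' = a' ∨ e' = b') ∧
      wdist G w e t' + wdist G w e' t ≤ wdist G w e t + wdist G w e' t' := by
  obtain ⟨p, hp⟩ := exists_walkWeight_eq_wdist hG hw a t
  obtain ⟨q, hq⟩ := exists_walkWeight_eq_wdist hG hw b t
  obtain ⟨p', hp'⟩ := exists_walkWeight_eq_wdist hG hw a' t'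
  obtain ⟨q', hq'⟩ := exists_walkWeight_eq_wdist hG hw b' t'
  obtain ⟨x, hx, hx'⟩ := h (p.append q.reverse) (p'.append q'.reverse)
  rw [SimpleGraph.Walk.mem_support_append_iff] at hx hx'
  have hxe : ∃ e, (e = a ∨ e = b) ∧ wdist G w e x + wdist G w x t ≤ wdist G w e t := by
    rcases hx with hx | hx
    · exact ⟨a, Or.inl rfl, wdist_add_le_of_mem_support hw hp hx⟩
    · exact ⟨b, Or.inr rfl, wdist_add_le_of_mem_support hw hq (by simpa using hx)⟩
  have hxe' : ∃ e', (e' = a' ∨ e' = b') ∧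
      wdist G w e' x + wdist G w x t' ≤ wdist G w e' t' := by
    rcases hx' with hx | hx
    · exact ⟨a', Or.inl rfl, wdist_add_le_of_mem_support hw hp' hx⟩
    · exact ⟨b', Or.inr rfl, wdist_add_le_of_mem_support hw hq' (by simpa using hx)⟩
  obtain ⟨e, he, h1⟩ := hxe
  obtain ⟨e', he', h2⟩ := hxe'
  refine ⟨e, e', he, he', ?_⟩
  have h3 := wdist_triangle hG hw e x t'
  have h4 := wdist_triangle hG hw e' x t
  linarith

end Metric

section Shattering

open Finset

variable {V : Type*} [Fintype V] {G : SimpleGraph V} {w : Sym2 V → ℝ}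

open Classical in
/-- The pairs of a source `s` and a multiple `k * η` such that the distance of `t` to `s` exceeds
that to `p` by at most `k * η`. -/
noncomputable def sublevel (G : SimpleGraph V) (w : Sym2 V → ℝ) (S : Finset V) (K : ℕ) (p : V)
    (η : ℝ) (t : V) : Finset (S × Fin K) :=
  {x | wdist G w x.1 t - wdist G w p t ≤ (x.2 : ℕ) * η}

omit [Fintype V] in
lemma mem_sublevel {S : Finset V} {K : ℕ} {p : V} {η : ℝ} {t : V} {x : S × Fin K} :
    x ∈ sublevel G w S K p η t ↔ wdist G w x.1 t - wdist G w p t ≤ (x.2 : ℕ) * η := by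
  simp [sublevel]

/-- A pivot and two crossing pairs cannot realize complementary threshold patterns. -/
lemma WalksMeet.not_complementary {p a b c : V} (h : WalksMeet G p b a c) (hG : G.Connected)
    (hw : ∀ e ∈ G.edgeSet, 0 < w e) {α β γ : ℝ} {t t' : V}
    (ha : wdist G w a t - wdist G w p t ≤ α) (hb : ¬wdist G w b t - wdist G w p t ≤ β)
    (hc : wdist G w c t - wdist G w p t ≤ γ) (ha' : ¬wdist G w a t' - wdist G w p t' ≤ α)
    (hb' : wdist G w b t' - wdist G w p t' ≤ β) (hc' : ¬wdist G w c t' - wdist G w p t' ≤ γ) :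
    False := by
  obtain ⟨e, e', rfl | rfl, rfl | rfl, h⟩ := h.exists_exchange hG hw t' t <;> linarith

variable [DecidableEq V]

theorem vcDim_sublevel_le (R : RotationSystem G) (hG : G.Connected) (hR : R.IsPlanar)
    (hw : ∀ e ∈ G.edgeSet, 0 < w e) {S : Finset V} (hS : R.OnSingleFace S) {p : V} (hp : p ∈ S)
    (K : ℕ) {η : ℝ} (hη : 0 ≤ η) :
    (univ.image (sublevel G w S K p η)).vcDim ≤ 2 := by
  refine Finset.sup_le fun A hA => ?_
  rw [mem_shatterer] at hA
  by_contra! hcard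
  obtain ⟨⟨s₁, k₁⟩, ⟨s₂, k₂⟩, ⟨s₃, k₃⟩, hx₁, hx₂, hx₃, h₁₂, h₁₃, h₂₃⟩ := two_lt_card_iff.1 hcard
  have hpat : ∀ P : S × Fin K → Prop, ∃ t, ∀ x ∈ A,
      (wdist G w x.1 t - wdist G w p t ≤ (x.2 : ℕ) * η ↔ P x) := by
    classical
    intro P
    obtain ⟨u, hu, h⟩ := hA (filter_subset P A)
    obtain ⟨t, -, rfl⟩ := mem_image.1 hu
    refine ⟨t, fun x hx => ?_⟩
    rw [← mem_sublevel]
    have := congrArg (x ∈ ·) h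
    simpa [hx] using this
  have hne_p : ∀ x ∈ A, x.1.1 ≠ p := by
    intro x hx h
    obtain ⟨t, ht⟩ := hpat fun _ => False
    refine (ht x hx).1 ?_
    rw [h, sub_self]
    positivity
  have hne : ∀ x ∈ A, ∀ y ∈ A, x ≠ y → x.1.1 ≠ y.1.1 := by
    intro x hx y hy hxy h
    obtain ⟨t, ht⟩ := hpat fun z => z = x
    obtain ⟨t', ht'⟩ := hpat fun z => z = y
    have h1 := (ht x hx).2 rfl
    have h2 := mt (ht y hy).1 hxy.symm
    have h3 := mt (ht' x hx).1 hxy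
    have h4 := (ht' y hy).2 rfl
    rw [h] at h1 h3
    linarith
  have key : ∀ x ∈ A, ∀ y ∈ A, ∀ z ∈ A, x ≠ y → y ≠ z → WalksMeet G p y.1 x.1 z.1 → False := by
    intro x hx y hy z hz hxy hyz h
    obtain ⟨t, ht⟩ := hpat fun u => u ≠ y
    obtain ⟨t', ht'⟩ := hpat fun u => u = y
    exact h.not_complementary hG hw ((ht x hx).2 hxy) (fun h => (ht y hy).1 h rfl)
      ((ht z hz).2 hyz.symm) (mt (ht' x hx).1 hxy) ((ht' y hy).2 rfl) (mt (ht' z hz).1 hyz.symm)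
  rcases R.walksMeet_of_onSingleFace hG hR hS hp s₁.2 s₂.2 s₃.2 (hne_p _ hx₁) (hne_p _ hx₂)
    (hne_p _ hx₃) (hne _ hx₁ _ hx₂ h₁₂) (hne _ hx₁ _ hx₃ h₁₃) (hne _ hx₂ _ hx₃ h₂₃) with h | h | h
  · exact key _ hx₂ _ hx₁ _ hx₃ h₁₂.symm h₁₃ h
  · exact key _ hx₁ _ hx₂ _ hx₃ h₁₂ h₂₃ h
  · exact key _ hx₁ _ hx₃ _ hx₂ h₁₃ h₂₃.symm h

/-- There are only polynomially many patterns of distances from sources on one face. -/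
theorem card_image_sublevel_le (R : RotationSystem G) (hG : G.Connected) (hR : R.IsPlanar)
    (hw : ∀ e ∈ G.edgeSet, 0 < w e) {S : Finset V} (hS : R.OnSingleFace S) {p : V} (hp : p ∈ S)
    (K : ℕ) {η : ℝ} (hη : 0 ≤ η) :
    #(univ.image (sublevel G w S K p η)) ≤ 1 + #S * K + (#S * K) ^ 2 := by
  refine (card_le_card_shatterer _).trans (card_shatterer_le_sum_vcDim.trans ?_)
  refine (sum_le_sum_of_subset (Iic_subset_Iic.2 (vcDim_sublevel_le R hG hR hw hS hp K hη))).trans ?_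
  have h2 : (Iic 2 : Finset ℕ) = {0, 1, 2} := rfl
  rw [h2]
  simp only [Fintype.card_prod, Fintype.card_coe, Fintype.card_fin]
  have := Nat.choose_le_pow (#S * K) 2
  simp
  omega

end Shattering

section Tables

open Finset

/-- A list of bits with a mark that ends it. -/
def delimited : List Bool → List Bool
  | [] => [false]
  | b :: l => true :: b :: delimited l

lemma length_delimited (l : List Bool) : (delimited l).length = 2 * l.length + 1 := by
  induction l with
  | nil => rfl
  | cons b l ih => simp only [delimited, List.length_cons, ih]; ring

lemma delimited_append_inj {l l' r r' : List Bool} (h : delimited l ++ r = delimited l' ++ r') :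
    l = l' ∧ r = r' := by
  induction l generalizing l' with
  | nil => cases l' <;> simp_all [delimited]
  | cons b l ih =>
    cases l' with
    | nil => simp [delimited] at h
    | cons b' l' =>
      simp only [delimited, List.cons_append, List.cons.injEq, true_and] at h
      obtain ⟨rfl, h⟩ := h
      obtain ⟨rfl, rfl⟩ := ih h
      exact ⟨rfl, rfl⟩

lemma bits_injective : Function.Injective Nat.bits := by
  intro m n h
  refine Nat.eq_of_testBit_eq fun i => ?_
  rw [Nat.testBit_eq_inth, Nat.testBit_eq_inth, h]

/-- Self-delimiting code of a table entry: a key and its value. -/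
def entryCode (x : (ℕ × ℕ × ℕ) × ℕ) : List Bool :=
  delimited x.1.1.bits ++ (delimited x.1.2.1.bits ++
    (delimited x.1.2.2.bits ++ delimited x.2.bits))

/-- The number of bits of the code of a table entry. -/
def entryCost (k : ℕ × ℕ × ℕ) (v : ℕ) : ℕ :=
  2 * (k.1.size + k.2.1.size + k.2.2.size + v.size) + 4

lemma length_entryCode (k : ℕ × ℕ × ℕ) (v : ℕ) : (entryCode (k, v)).length = entryCost k v := by
  simp only [entryCode, entryCost, List.length_append, length_delimited, ← Nat.size_eq_bits_len]
  ring

lemma entryCode_append_inj {x y : (ℕ × ℕ × ℕ) × ℕ} {r r' : List Bool}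
    (h : entryCode x ++ r = entryCode y ++ r') : x = y ∧ r = r' := by
  obtain ⟨⟨a, b, c⟩, d⟩ := x
  obtain ⟨⟨a', b', c'⟩, d'⟩ := y
  simp only [entryCode, List.append_assoc] at h
  obtain ⟨h1, h⟩ := delimited_append_inj h
  obtain ⟨h2, h⟩ := delimited_append_inj h
  obtain ⟨h3, h⟩ := delimited_append_inj h
  obtain ⟨h4, h⟩ := delimited_append_inj h
  rw [bits_injective h1, bits_injective h2, bits_injective h3, bits_injective h4]
  exact ⟨rfl, h⟩

lemma entryCode_ne_nil (x : (ℕ × ℕ × ℕ) × ℕ) : entryCode x ≠ [] := by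
  intro h
  have := congrArg List.length h
  rw [length_entryCode x.1 x.2, entryCost] at this
  simp at this

lemma flatMap_entryCode_injective :
    Function.Injective fun l : List ((ℕ × ℕ × ℕ) × ℕ) => l.flatMap entryCode := by
  intro l
  induction l with
  | nil =>
    intro l' h
    cases l' with
    | nil => rfl
    | cons x l' => simp [entryCode_ne_nil] at h
  | cons x l ih =>
    intro l' h
    cases l' with
    | nil => simp [entryCode_ne_nil] at h
    | cons y l' =>
      simp only [List.flatMap_cons] at h
      obtain ⟨rfl, hl⟩ := entryCode_append_inj h
      rw [ih hl]

/-- The bit string that lists the nonzero entries of a table. -/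
noncomputable def encodeTable (f : ℕ × ℕ × ℕ →₀ ℕ) : List Bool :=
  f.graph.toList.flatMap entryCode

lemma encodeTable_injective : Function.Injective encodeTable := by
  intro f g h
  have := flatMap_entryCode_injective h
  exact Finsupp.graph_injective _ _ (by rw [← toList_toFinset f.graph, this, toList_toFinset])

/-- Recovers a table from its bit string. -/
noncomputable def decodeTable : List Bool → (ℕ × ℕ × ℕ →₀ ℕ) :=
  Function.invFun encodeTable

lemma decodeTable_encodeTable (f : ℕ × ℕ × ℕ →₀ ℕ) : decodeTable (encodeTable f) = f :=
  Function.leftInverse_invFun encodeTable_injective f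

lemma length_encodeTable (f : ℕ × ℕ × ℕ →₀ ℕ) :
    (encodeTable f).length = ∑ k ∈ f.support, entryCost k (f k) := by
  rw [encodeTable, List.length_flatMap, Finset.sum_map_toList, Finsupp.graph, sum_map]
  exact sum_congr rfl fun k _ => length_entryCode k (f k)

/-- The table of a function on a finite set of keys. -/
lemma exists_encoding (K : Finset (ℕ × ℕ × ℕ)) (g : ℕ × ℕ × ℕ → ℕ) :
    ∃ b : List Bool, (∀ k ∈ K, decodeTable b k = g k) ∧
      b.length ≤ ∑ k ∈ K, entryCost k (g k) := by
  let f : ℕ × ℕ × ℕ →₀ ℕ := Finsupp.indicator K fun k _ => g k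
  have hf : ∀ k ∈ K, f k = g k := fun k hk => Finsupp.indicator_of_mem hk _
  refine ⟨encodeTable f, fun k hk => ?_, ?_⟩
  · rw [decodeTable_encodeTable, hf k hk]
  · rw [length_encodeTable]
    have hsub : f.support ⊆ K := Finsupp.support_indicator_subset _ _
    refine (sum_le_sum_of_subset hsub).trans (sum_le_sum fun k hk => ?_)
    rw [hf k hk]

lemma size_le_of_le {x n : ℕ} (hn : 1 ≤ n) (hx : x ≤ n) :
    (x.size : ℝ) ≤ 2 * (1 + Real.log n) := by
  have h1 : (x.size : ℝ) ≤ n.size := by exact_mod_cast Nat.size_le_size hx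
  have h2 : 2 ^ (n.size - 1) ≤ n := Nat.lt_size.1 (by have := Nat.size_pos.2 hn; omega)
  have h3 : ((n.size - 1 : ℕ) : ℝ) * Real.log 2 ≤ Real.log n := by
    rw [← Real.log_pow]
    exact Real.log_le_log (by positivity) (by exact_mod_cast h2)
  have h4 : (n.size : ℝ) ≤ ((n.size - 1 : ℕ) : ℝ) + 1 := by
    exact_mod_cast (by omega : n.size ≤ n.size - 1 + 1)
  have h5 := Real.log_two_gt_d9
  have h6 : (0 : ℝ) ≤ ((n.size - 1 : ℕ) : ℝ) := by positivity
  nlinarith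

lemma size_le_self (v : ℕ) : v.size ≤ v :=
  Nat.size_le.2 Nat.lt_two_pow_self

end Tables

section Rounding

open Finset

variable {V : Type*} [Fintype V]

/-- The exponent of the largest power of two that is at most the distance, in units of the
smallest distance. -/
noncomputable def scale (G : SimpleGraph V) (w : Sym2 V → ℝ) (u v : V) : ℕ :=
  Nat.log 2 ⌊wdist G w u v / minDist G w⌋₊

/-- The unit of length in which distances of the scale of the one from `u` to `v` are rounded. -/
noncomputable def unitLength (G : SimpleGraph V) (w : Sym2 V → ℝ) (L : ℕ) (u v : V) : ℝ :=
  2 ^ scale G w u v * minDist G w / L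

/-- The distance in multiples of the unit length of its scale, rounded up. -/
noncomputable def mantissa (G : SimpleGraph V) (w : Sym2 V → ℝ) (L : ℕ) (u v : V) : ℕ :=
  ⌈wdist G w u v / unitLength G w L u v⌉₊

variable {G : SimpleGraph V} {w : Sym2 V → ℝ} [Nontrivial V]

lemma pow_scale_mul_le (hG : G.Connected) (hw : ∀ e ∈ G.edgeSet, 0 < w e) {u v : V} (huv : u ≠ v) :
    2 ^ scale G w u v * minDist G w ≤ wdist G w u v := by
  have hμ := minDist_pos hG hw
  rw [← le_div_iff₀ hμ]
  have h1 : 1 ≤ wdist G w u v / minDist G w := (one_le_div hμ).2 (minDist_le_wdist huv)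
  have h2 : ⌊wdist G w u v / minDist G w⌋₊ ≠ 0 := (Nat.floor_pos.2 h1).ne'
  have h3 := Nat.pow_log_le_self 2 h2
  refine le_trans ?_ (Nat.floor_le (by linarith))
  exact_mod_cast h3

lemma lt_pow_scale_mul (hG : G.Connected) (hw : ∀ e ∈ G.edgeSet, 0 < w e) (u v : V) :
    wdist G w u v < 2 * (2 ^ scale G w u v * minDist G w) := by
  have hμ := minDist_pos hG hw
  have h := Nat.lt_pow_succ_log_self (b := 2) (by norm_num) ⌊wdist G w u v / minDist G w⌋₊
  have h2 := Nat.lt_of_floor_lt h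
  rw [div_lt_iff₀ hμ] at h2
  push_cast at h2
  rw [pow_succ] at h2
  rw [scale]
  linarith

lemma one_le_aspectRatio (hG : G.Connected) (hw : ∀ e ∈ G.edgeSet, 0 < w e) :
    1 ≤ aspectRatio G w := by
  obtain ⟨u, v, huv⟩ := exists_pair_ne V
  exact (one_le_div (minDist_pos hG hw)).2 ((minDist_le_wdist huv).trans (wdist_le_maxDist huv))

lemma scale_le (hG : G.Connected) (hw : ∀ e ∈ G.edgeSet, 0 < w e) (u v : V) :
    (scale G w u v : ℝ) ≤ 2 * Real.log (aspectRatio G w) := by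
  have hW := Real.log_nonneg (one_le_aspectRatio hG hw)
  by_cases huv : u = v
  · subst huv
    rw [scale, wdist_self hw]
    simpa using hW
  · have hμ := minDist_pos hG hw
    have h1 : (2 : ℝ) ^ scale G w u v ≤ aspectRatio G w :=
      (le_div_iff₀ hμ).2 ((pow_scale_mul_le hG hw huv).trans (wdist_le_maxDist huv))
    have h2 := Real.log_le_log (by positivity) h1
    rw [Real.log_pow] at h2
    have h3 := Real.log_two_gt_d9
    have h4 : (0 : ℝ) ≤ scale G w u v := by positivity
    nlinarith

lemma unitLength_pos (hG : G.Connected) (hw : ∀ e ∈ G.edgeSet, 0 < w e) {L : ℕ} (hL : 0 < L)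
    (u v : V) : 0 < unitLength G w L u v := by
  have hμ := minDist_pos hG hw
  rw [unitLength]
  positivity

omit [Fintype V] [Nontrivial V] in
lemma mul_unitLength {L : ℕ} (hL : 0 < L) (u v : V) :
    L * unitLength G w L u v = 2 ^ scale G w u v * minDist G w := by
  rw [unitLength]
  field_simp

lemma le_mantissa_mul (hG : G.Connected) (hw : ∀ e ∈ G.edgeSet, 0 < w e) {L : ℕ} (hL : 0 < L)
    (u v : V) : wdist G w u v ≤ mantissa G w L u v * unitLength G w L u v :=
  (div_le_iff₀ (unitLength_pos hG hw hL u v)).1 (Nat.le_ceil _)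

lemma mantissa_mul_le (hG : G.Connected) (hw : ∀ e ∈ G.edgeSet, 0 < w e) {L : ℕ} (hL : 0 < L)
    {u v : V} (huv : u ≠ v) :
    mantissa G w L u v * unitLength G w L u v ≤ wdist G w u v + unitLength G w L u v := by
  have hη := unitLength_pos hG hw hL u v
  have h := (Nat.ceil_lt_add_one (div_pos (wdist_pos hG hw huv) hη).le).le
  calc _ ≤ (wdist G w u v / unitLength G w L u v + 1) * unitLength G w L u v := by
        rw [mantissa]; gcongr
    _ = _ := by field_simp

lemma mantissa_le (hG : G.Connected) (hw : ∀ e ∈ G.edgeSet, 0 < w e) {L : ℕ} (hL : 0 < L)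
    (u v : V) : mantissa G w L u v ≤ 2 * L := by
  rw [mantissa, Nat.ceil_le, div_le_iff₀ (unitLength_pos hG hw hL u v)]
  push_cast
  rw [mul_assoc, mul_unitLength hL]
  exact (lt_pow_scale_mul hG hw u v).le

lemma mantissa_pos (hG : G.Connected) (hw : ∀ e ∈ G.edgeSet, 0 < w e) {L : ℕ} (hL : 0 < L)
    {u v : V} (huv : u ≠ v) : 0 < mantissa G w L u v :=
  Nat.ceil_pos.2 (div_pos (wdist_pos hG hw huv) (unitLength_pos hG hw hL u v))

/-- What is recorded of the position of a target relative to the sources: its pivot `p`, the scale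
and the rounded value of the distance to `p`, and the rounded differences to the distances from the
other sources. -/
noncomputable def signature (G : SimpleGraph V) (w : Sym2 V → ℝ) (S : Finset V) (L : ℕ) (p t : V) :
    V × ℕ × ℕ × Finset (S × Fin (L ^ 2 + 1)) :=
  (p, scale G w p t, mantissa G w L p t, sublevel G w S (L ^ 2 + 1) p (unitLength G w L p t) t)

open Classical in
/-- The rounded distance from `s` that is read off from a signature, or `0` if `s` is far away. -/
noncomputable def roundedDist {S : Finset V} {K : ℕ}
    (x : V × ℕ × ℕ × Finset (S × Fin K)) (s : V) : ℕ :=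
  if h : ∃ k : ℕ, ∃ (hs : s ∈ S) (hk : k < K), (⟨s, hs⟩, ⟨k, hk⟩) ∈ x.2.2.2 then
    x.2.2.1 + Nat.find h else 0

lemma roundedDist_signature_le (hG : G.Connected) (hw : ∀ e ∈ G.edgeSet, 0 < w e) {S : Finset V}
    {L : ℕ} (hL : 0 < L) (p t s : V) : roundedDist (signature G w S L p t) s ≤ 3 * L ^ 2 := by
  classical
  rw [roundedDist]
  split_ifs with h
  · obtain ⟨_, hk, -⟩ := Nat.find_spec h
    have := mantissa_le hG hw hL p t
    simp only [signature]
    simp only [signature] at hk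
    nlinarith
  · positivity

lemma roundedDist_signature (hG : G.Connected) (hw : ∀ e ∈ G.edgeSet, 0 < w e) {S : Finset V}
    {L : ℕ} (hL : 0 < L) {p t s : V} (hpt : p ≠ t) (hs : s ∈ S)
    (hp : wdist G w p t ≤ wdist G w s t) :
    (roundedDist (signature G w S L p t) s ≠ 0 ∧
      wdist G w s t ≤ roundedDist (signature G w S L p t) s * unitLength G w L p t ∧
      roundedDist (signature G w S L p t) s * unitLength G w L p t ≤
        wdist G w s t + 2 * unitLength G w L p t) ∨
    (roundedDist (signature G w S L p t) s = 0 ∧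
      L * (2 ^ scale G w p t * minDist G w) < wdist G w s t - wdist G w p t) := by
  classical
  have hη := unitLength_pos hG hw hL p t
  have h1 := le_mantissa_mul hG hw hL p t
  have h2 := mantissa_mul_le hG hw hL hpt
  by_cases h : ∃ k : ℕ, ∃ (hs : s ∈ S) (hk : k < L ^ 2 + 1),
      ((⟨s, hs⟩, ⟨k, hk⟩) : S × Fin (L ^ 2 + 1)) ∈ (signature G w S L p t).2.2.2
  · left
    have heq : roundedDist (signature G w S L p t) s = mantissa G w L p t + Nat.find h := by
      rw [roundedDist, dif_pos h]; rfl
    obtain ⟨_, hk, hmem⟩ := Nat.find_spec h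
    have hmin := fun {m : ℕ} => Nat.find_min h (m := m)
    generalize Nat.find h = k at *
    rw [heq]
    simp only [signature, mem_sublevel] at hmem hmin
    refine ⟨by have := mantissa_pos hG hw hL hpt; omega, ?_, ?_⟩
    · push_cast; linarith
    · have h3 : k * unitLength G w L p t ≤
          wdist G w s t - wdist G w p t + unitLength G w L p t := by
        cases k with
        | zero => push_cast; linarith
        | succ k =>
          by_contra! hlt
          refine hmin (Nat.lt_succ_self k) ⟨hs, by omega, ?_⟩
          push_cast at hlt
          linarith
      push_cast; linarith
  · right
    refine ⟨by rw [roundedDist, dif_neg h], ?_⟩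
    by_contra! hle
    refine h ⟨L ^ 2, hs, by omega, ?_⟩
    simp only [signature, mem_sublevel]
    push_cast
    rw [pow_two, mul_assoc, mul_unitLength hL]
    exact hle

open Classical in
lemma card_image_signature_le (R : RotationSystem G) (hG : G.Connected)
    (hR : R.IsPlanar) (hw : ∀ e ∈ G.edgeSet, 0 < w e) {S : Finset V} (hS : R.OnSingleFace S)
    {L : ℕ} (hL : 0 < L) {pv : V → V} (hpv : ∀ t, pv t ∈ S) {J : ℕ}
    (hJ : ∀ u v, scale G w u v < J) (T : Finset V) :
    #(T.image fun t => signature G w S L (pv t) t) ≤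
      #S * J * (2 * L + 1) * (1 + #S * (L ^ 2 + 1) + (#S * (L ^ 2 + 1)) ^ 2) := by
  have hsub : (T.image fun t => signature G w S L (pv t) t) ⊆
      (S ×ˢ range J ×ˢ range (2 * L + 1)).biUnion fun x =>
        (univ.image (sublevel G w S (L ^ 2 + 1) x.1 (2 ^ x.2.1 * minDist G w / L))).image
          fun X => (x.1, x.2.1, x.2.2, X) := by
    intro y hy
    obtain ⟨t, -, rfl⟩ := mem_image.1 hy
    refine mem_biUnion.2 ⟨(pv t, scale G w (pv t) t, mantissa G w L (pv t) t), ?_, ?_⟩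
    · have := mantissa_le hG hw hL (pv t) t
      simp only [mem_product, mem_range]
      exact ⟨hpv t, hJ _ _, by omega⟩
    · exact mem_image.2 ⟨_, mem_image_of_mem _ (mem_univ t), rfl⟩
  refine (card_le_card hsub).trans ((card_biUnion_le_card_mul _ _
    (1 + #S * (L ^ 2 + 1) + (#S * (L ^ 2 + 1)) ^ 2) fun x hx => ?_).trans_eq ?_)
  · refine card_image_le.trans (card_image_sublevel_le R hG hR hw hS (mem_product.1 hx).1 _ ?_)
    have := minDist_pos hG hw
    positivity
  · simp only [card_product, card_range]
    ring

end Rounding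

section Compression

open Finset

/-- The decoder. The table contains: under `(0, t, 0)` the pivot of a target `t`, under `(1, t, 0)`
the scale of its distance to the pivot, under `(2, t, 0)` the number of its signature, under
`(3, c, s)` the rounded distance from `s` for the signature with the number `c`, under `(4, p, s)`
and `(5, p, s)` mantissa and scale of the distance from `s` to `p`, and under `(6, 0, 0)` the
number of steps into which a scale is divided. -/
noncomputable def decodeDist (b : List Bool) (s t : ℕ) : ℝ :=
  let g := decodeTable b
  if s = t then 0
  else if g (3, g (2, t, 0), s) = 0 then
    (1 + 2 / g (6, 0, 0)) *
      (g (4, g (0, t, 0), s) * (2 ^ g (5, g (0, t, 0), s) / g (6, 0, 0)))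
  else g (3, g (2, t, 0), s) * (2 ^ g (1, t, 0) / g (6, 0, 0))

lemma far_estimate {D F d r L ε : ℝ} (hD : 0 ≤ D) (hL : 0 < L) (hε : ε ≤ 1) (hLε : 8 ≤ L * ε)
    (hF : D ≤ F) (hF' : F ≤ D + D / L) (h₁ : d ≤ D + r) (h₂ : D ≤ d + r) (hr : L * r ≤ 2 * D) :
    d ≤ (1 + 2 / L) * F ∧ (1 + 2 / L) * F ≤ (1 + ε) * d := by
  obtain ⟨y, hy⟩ : ∃ y, y = 1 / L := ⟨_, rfl⟩
  have hy0 : 0 < y := by rw [hy]; positivity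
  have hLy : L * y = 1 := by rw [hy]; field_simp
  have hy8 : 8 * y ≤ ε := by nlinarith
  have hr' : r ≤ 2 * D * y := by
    have := mul_le_mul_of_nonneg_right hr hy0.le
    nlinarith
  have e1 : 2 / L = 2 * y := by rw [hy]; ring
  have e2 : D / L = D * y := by rw [hy]; ring
  rw [e1]
  rw [e2] at hF'
  constructor
  · nlinarith
  · have hd : D * (1 - 2 * y) ≤ d := by linarith
    have hd0 : 0 ≤ d := le_trans (mul_nonneg hD (by linarith)) hd
    calc (1 + 2 * y) * F ≤ (1 + 2 * y) * (D + D * y) := by gcongr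
      _ = D * ((1 + 2 * y) * (1 + y)) := by ring
      _ ≤ D * ((1 + 8 * y) * (1 - 2 * y)) := by
        refine mul_le_mul_of_nonneg_left ?_ hD
        nlinarith
      _ = (1 + 8 * y) * (D * (1 - 2 * y)) := by ring
      _ ≤ (1 + 8 * y) * d := by gcongr
      _ ≤ (1 + ε) * d := by gcongr

lemma exists_numbering {α : Type*} [Nonempty α] (A : Finset α) :
    ∃ (idx : α → ℕ) (inv : ℕ → α), (∀ x ∈ A, idx x < #A ∧ inv (idx x) = x) ∧
      ∀ i < #A, inv i ∈ A := by
  classical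
  refine ⟨fun x => if h : x ∈ A then A.equivFin ⟨x, h⟩ else 0,
    fun i => if h : i < #A then A.equivFin.symm ⟨i, h⟩ else Classical.arbitrary α, ?_, ?_⟩
  · intro x hx
    simp [hx]
  · intro i hi
    simp [hi]

lemma exists_pivot {V : Type*} [Fintype V] {G : SimpleGraph V} {w : Sym2 V → ℝ} {S : Finset V}
    (hG : G.Connected) (hw : ∀ e ∈ G.edgeSet, 0 < w e) (hS : S.Nonempty) :
    ∃ pv : V → V, (∀ t, pv t ∈ S) ∧ (∀ t, ∀ s ∈ S, wdist G w (pv t) t ≤ wdist G w s t) ∧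
      ∀ t ∈ S, pv t = t := by
  choose pv hpv using fun t => S.exists_min_image (fun s => wdist G w s t) hS
  refine ⟨pv, fun t => (hpv t).1, fun t => (hpv t).2, fun t ht => ?_⟩
  by_contra h
  have h1 := (hpv t).2 t ht
  have h2 := wdist_pos hG hw h
  rw [wdist_self hw] at h1
  linarith

variable {n : ℕ} [NeZero n] {G : SimpleGraph (Fin n)} {w : Sym2 (Fin n) → ℝ}

/-- The entries of the table from which distances are decoded. -/
noncomputable def tableEntry {α : Type*} (G : SimpleGraph (Fin n)) (w : Sym2 (Fin n) → ℝ) (L : ℕ)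
    (pv : Fin n → Fin n) (cls : Fin n → ℕ) (inv : ℕ → α) (rd : α → Fin n → ℕ) :
    ℕ × ℕ × ℕ → ℕ
  | (0, t, _) => pv (Fin.ofNat n t)
  | (1, t, _) => scale G w (pv (Fin.ofNat n t)) (Fin.ofNat n t)
  | (2, t, _) => cls (Fin.ofNat n t)
  | (3, 0, _) => 0
  | (3, c + 1, s) => rd (inv c) (Fin.ofNat n s)
  | (4, p, s) => mantissa G w L (Fin.ofNat n s) (Fin.ofNat n p)
  | (5, p, s) => scale G w (Fin.ofNat n s) (Fin.ofNat n p)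
  | _ => L

/-- The keys of the table from which distances are decoded. -/
def tableKeys (S T : Finset (Fin n)) (m : ℕ) : Finset (ℕ × ℕ × ℕ) :=
  ({0, 1, 2} ×ˢ T.map Fin.valEmbedding ×ˢ {0}) ∪
    (({3} ×ˢ range (m + 1) ×ˢ S.map Fin.valEmbedding) ∪
      (({4, 5} ×ˢ S.map Fin.valEmbedding ×ˢ S.map Fin.valEmbedding) ∪ {(6, 0, 0)}))

omit [NeZero n] in
lemma sum_tableKeys_le (S T : Finset (Fin n)) (m : ℕ) (f : ℕ × ℕ × ℕ → ℕ) {B₁ B₂ B₃ B₄ : ℝ}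
    (h₁ : ∀ τ < 3, ∀ t ∈ T, (f (τ, (t : ℕ), 0) : ℝ) ≤ B₁)
    (h₂ : ∀ c ≤ m, ∀ s ∈ S, (f (3, c, (s : ℕ)) : ℝ) ≤ B₂)
    (h₃ : ∀ τ, τ = 4 ∨ τ = 5 → ∀ p ∈ S, ∀ s ∈ S, (f (τ, (p : ℕ), (s : ℕ)) : ℝ) ≤ B₃)
    (h₄ : (f (6, 0, 0) : ℝ) ≤ B₄) :
    ((∑ k ∈ tableKeys S T m, f k : ℕ) : ℝ) ≤
      3 * #T * B₁ + (m + 1) * #S * B₂ + 2 * #S ^ 2 * B₃ + B₄ := by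
  have hunion : ∀ A B : Finset (ℕ × ℕ × ℕ), (∑ k ∈ A ∪ B, (f k : ℝ)) ≤
      (∑ k ∈ A, (f k : ℝ)) + ∑ k ∈ B, (f k : ℝ) := by
    intro A B
    rw [← sum_union_inter]
    exact le_add_of_nonneg_right (sum_nonneg fun k _ => by positivity)
  have hbound : ∀ (A : Finset (ℕ × ℕ × ℕ)) (B : ℝ), (∀ k ∈ A, (f k : ℝ) ≤ B) →
      (∑ k ∈ A, (f k : ℝ)) ≤ #A * B := by
    intro A B h
    simpa using sum_le_card_nsmul A (fun k => (f k : ℝ)) B h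
  push_cast
  rw [tableKeys]
  refine (hunion _ _).trans ?_
  rw [add_assoc, add_assoc]
  refine add_le_add ((hbound _ B₁ ?_).trans_eq ?_) ((hunion _ _).trans (add_le_add
    ((hbound _ B₂ ?_).trans_eq ?_) ((hunion _ _).trans (add_le_add
      ((hbound _ B₃ ?_).trans_eq ?_) ?_))))
  · rintro ⟨τ, t, z⟩ h
    simp only [mem_product, mem_insert, mem_singleton, mem_map, Fin.valEmbedding_apply] at h
    obtain ⟨hτ, ⟨t, ht, rfl⟩, rfl⟩ := h
    exact h₁ τ (by omega) t ht
  · simp [card_product]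
  · rintro ⟨τ, c, s⟩ h
    simp only [mem_product, mem_singleton, mem_map, Fin.valEmbedding_apply, mem_range] at h
    obtain ⟨rfl, hc, s, hs, rfl⟩ := h
    exact h₂ c (by omega) s hs
  · simp [card_product]
  · rintro ⟨τ, p, s⟩ h
    simp only [mem_product, mem_insert, mem_singleton, mem_map, Fin.valEmbedding_apply] at h
    obtain ⟨hτ, ⟨p, hp, rfl⟩, s, hs, rfl⟩ := h
    exact h₃ τ hτ p hp s hs
  · simp only [card_product, card_map, card_pair (by norm_num : (4 : ℕ) ≠ 5)]
    push_cast
    ring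
  · simpa using h₄

lemma entryCost_le {x y z v : ℕ} (hx : x ≤ 6) (hy : y ≤ n) (hz : z ≤ n) :
    (entryCost (x, y, z) v : ℝ) ≤ 18 * (1 + Real.log n) + 2 * v.size := by
  have hn : 1 ≤ n := NeZero.one_le
  have h1 : x.size ≤ 3 := (Nat.size_le_size hx).trans (by decide)
  have h1' : (x.size : ℝ) ≤ 3 := by exact_mod_cast h1
  have h2 := size_le_of_le hn hy
  have h3 := size_le_of_le hn hz
  have h4 : 0 ≤ Real.log n := Real.log_natCast_nonneg n
  simp only [entryCost]
  push_cast
  linarith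

lemma length_bound {t s L m ℓ Λ x : ℝ} (hs : 1 ≤ s) (hL : 1 ≤ L) (hℓ : 1 ≤ ℓ) (hΛ : 1 ≤ Λ)
    (ht : 0 ≤ t) (hm : m ≤ 72 * Λ * s ^ 3 * L ^ 5) (hx : s * L ≤ 9 * x) :
    3 * t * (26 * (ℓ * Λ)) + (m + 1) * s * (24 * (ℓ * L ^ 2)) + 2 * s ^ 2 * (26 * (ℓ * L * Λ)) +
      20 * (ℓ * L) ≤ 2000 * 9 ^ 7 * (x ^ 7 + t) * Λ * ℓ ^ 7 := by
  have hs0 : 0 < s := by linarith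
  have hL0 : 0 < L := by linarith
  have hℓ0 : 0 < ℓ := by linarith
  have hΛ0 : 0 < Λ := by linarith
  have hA : 1 ≤ s ^ 2 := one_le_pow₀ hs
  have hB : 1 ≤ s ^ 4 := one_le_pow₀ hs
  have h3 : 1 ≤ s ^ 3 := one_le_pow₀ hs
  have h5 : 1 ≤ L ^ 5 := one_le_pow₀ hL
  have h6 : 1 ≤ L ^ 6 := one_le_pow₀ hL
  have e1 : (m + 1) * s * (24 * (ℓ * L ^ 2)) ≤ 1752 * (s ^ 4 * L ^ 7 * ℓ * Λ) := by
    have : m + 1 ≤ 73 * (Λ * s ^ 3 * L ^ 5) := by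
      have : 1 ≤ Λ * s ^ 3 * L ^ 5 := one_le_mul_of_one_le_of_one_le
        (one_le_mul_of_one_le_of_one_le hΛ h3) h5
      linarith
    calc _ ≤ 73 * (Λ * s ^ 3 * L ^ 5) * s * (24 * (ℓ * L ^ 2)) := by gcongr
      _ = _ := by ring
  have e2 : 2 * s ^ 2 * (26 * (ℓ * L * Λ)) ≤ 52 * (s ^ 4 * L ^ 7 * ℓ * Λ) := by
    calc _ = 52 * (s ^ 2 * 1 * (L * 1) * ℓ * Λ) := by ring
      _ ≤ 52 * (s ^ 2 * s ^ 2 * (L * L ^ 6) * ℓ * Λ) := by gcongr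
      _ = _ := by ring
  have e3 : 20 * (ℓ * L) ≤ 20 * (s ^ 4 * L ^ 7 * ℓ * Λ) := by
    calc _ = 20 * (1 * (L * 1) * ℓ * 1) := by ring
      _ ≤ 20 * (s ^ 4 * (L * L ^ 6) * ℓ * Λ) := by gcongr
      _ = _ := by ring
  have e4 : s ^ 4 * L ^ 7 ≤ 9 ^ 7 * x ^ 7 := by
    calc s ^ 4 * L ^ 7 ≤ s ^ 7 * L ^ 7 := by
          gcongr
          norm_num
      _ = (s * L) ^ 7 := by ring
      _ ≤ (9 * x) ^ 7 := by gcongr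
      _ = _ := by ring
  have e5 : ℓ ≤ ℓ ^ 7 := le_self_pow₀ hℓ (by norm_num)
  calc _ ≤ 78 * t * (ℓ * Λ) + 1824 * (s ^ 4 * L ^ 7 * ℓ * Λ) := by linarith
    _ ≤ 78 * t * (ℓ * Λ) + 1824 * (9 ^ 7 * x ^ 7 * ℓ * Λ) := by gcongr
    _ ≤ 2000 * 9 ^ 7 * t * (ℓ * Λ) + 2000 * (9 ^ 7 * x ^ 7 * ℓ * Λ) := by
      have hx0 : 0 ≤ x := by nlinarith
      gcongr <;> norm_num
    _ = 2000 * 9 ^ 7 * (x ^ 7 + t) * Λ * ℓ := by ring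
    _ ≤ _ := by
      have hx0 : 0 ≤ x := by nlinarith
      gcongr

/-- The distances from a set of sources on one face have a compression whose length is nearly
linear in the number of targets. -/
theorem exists_compression (R : RotationSystem G) {S : Finset (Fin n)} {ε : ℝ} [Nontrivial (Fin n)]
    (hG : G.Connected) (hw : ∀ e ∈ G.edgeSet, 0 < w e) (hR : R.IsPlanar) (hface : R.OnSingleFace S)
    (hε : 0 < ε) (hε₁ : ε ≤ 1) (hS : S.Nonempty) (T : Finset (Fin n)) :
    ∃ b : List Bool, IsCompression decodeDist G w S T ε b ∧
      (b.length : ℝ) ≤ 2000 * 9 ^ 7 * (((#S : ℝ) / ε) ^ 7 + #T) *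
        (1 + Real.log (aspectRatio G w)) * (1 + Real.log n) ^ 7 := by
  classical
  have hn : 1 ≤ n := NeZero.one_le
  have hμ := minDist_pos hG hw
  have hlogW := Real.log_nonneg (one_le_aspectRatio hG hw)
  have hlogn : 0 ≤ Real.log n := Real.log_natCast_nonneg n
  obtain ⟨L, hL8, hL9⟩ : ∃ L : ℕ, 8 / ε ≤ L ∧ (L : ℝ) ≤ 9 / ε := by
    refine ⟨⌈8 / ε⌉₊, Nat.le_ceil _, (Nat.ceil_lt_add_one (by positivity)).le.trans ?_⟩
    rw [div_add_one hε.ne']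
    gcongr
    linarith
  have hLε : 8 ≤ L * ε := (div_le_iff₀ hε).1 hL8
  have hL0' : (0 : ℝ) < L := lt_of_lt_of_le (by positivity) hL8
  have hL0 : 0 < L := by exact_mod_cast hL0'
  obtain ⟨pv, hpvS, hpv, hpv_self⟩ := exists_pivot hG hw hS
  let sig : Fin n → _ := fun t => signature G w S L (pv t) t
  let 𝒞 := (T \ S).image sig
  have : Nonempty (Fin n × ℕ × ℕ × Finset (S × Fin (L ^ 2 + 1))) := ⟨sig 0⟩
  obtain ⟨idx, inv, hidx, hinv⟩ := exists_numbering 𝒞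
  let cls : Fin n → ℕ := fun t => if t ∈ S then 0 else idx (sig t) + 1
  have hcls : ∀ t ∈ T, cls t ≤ #𝒞 := by
    intro t ht
    by_cases h : t ∈ S
    · simp [cls, h]
    · have := (hidx (sig t) (mem_image_of_mem _ (mem_sdiff.2 ⟨ht, h⟩))).1
      simp only [cls, h, if_false]
      omega
  have hm : #𝒞 ≤ n := by
    refine card_image_le.trans ((card_le_univ _).trans_eq ?_)
    simp
  let g := tableEntry G w L pv cls inv roundedDist
  obtain ⟨b, hb, hlen⟩ := exists_encoding (tableKeys S T #𝒞) g
  refine ⟨b, ?_, ?_⟩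
  · intro s hs t ht
    by_cases hst : s = t
    · subst hst
      simp [decodeDist, wdist_self hw]
    have hst' : (s : ℕ) ≠ t := fun h => hst (Fin.ext h)
    have hsS : (s : ℕ) ∈ S.map Fin.valEmbedding := mem_map_of_mem Fin.valEmbedding hs
    have htT : (t : ℕ) ∈ T.map Fin.valEmbedding := mem_map_of_mem Fin.valEmbedding ht
    have hpS : (pv t : ℕ) ∈ S.map Fin.valEmbedding := mem_map_of_mem Fin.valEmbedding (hpvS t)
    have g0 : decodeTable b (0, (t : ℕ), 0) = pv t := by
      rw [hb _ (by simp [tableKeys, htT, -mem_map])]; simp [g, tableEntry]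
    have g1 : decodeTable b (1, (t : ℕ), 0) = scale G w (pv t) t := by
      rw [hb _ (by simp [tableKeys, htT, -mem_map])]; simp [g, tableEntry]
    have g2 : decodeTable b (2, (t : ℕ), 0) = cls t := by
      rw [hb _ (by simp [tableKeys, htT, -mem_map])]; simp [g, tableEntry]
    have g3 : decodeTable b (3, cls t, (s : ℕ)) = g (3, cls t, (s : ℕ)) :=
      hb _ (by simp [tableKeys, hsS, hcls t ht, -mem_map])
    have g4 : decodeTable b (4, (pv t : ℕ), (s : ℕ)) = mantissa G w L s (pv t) := by
      rw [hb _ (by simp [tableKeys, hsS, hpS, -mem_map])]; simp [g, tableEntry]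
    have g5 : decodeTable b (5, (pv t : ℕ), (s : ℕ)) = scale G w s (pv t) := by
      rw [hb _ (by simp [tableKeys, hsS, hpS, -mem_map])]; simp [g, tableEntry]
    have g6 : decodeTable b (6, 0, 0) = L := by
      rw [hb _ (by simp [tableKeys])]; simp [g, tableEntry]
    have hfar : s ≠ pv t → L * wdist G w (pv t) t ≤ 2 * wdist G w s (pv t) →
        wdist G w s t ≤ minDist G w * ((1 + 2 / L) *
          (mantissa G w L s (pv t) * (2 ^ scale G w s (pv t) / L))) ∧
        minDist G w * ((1 + 2 / L) *
          (mantissa G w L s (pv t) * (2 ^ scale G w s (pv t) / L))) ≤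
            (1 + ε) * wdist G w s t := by
      intro hsp hr
      have e : minDist G w * ((1 + 2 / L) *
          (mantissa G w L s (pv t) * (2 ^ scale G w s (pv t) / L))) =
          (1 + 2 / L) * (mantissa G w L s (pv t) * unitLength G w L s (pv t)) := by
        rw [unitLength]; ring
      rw [e]
      refine far_estimate (D := wdist G w s (pv t)) (r := wdist G w (pv t) t)
        (wdist_pos hG hw hsp).le hL0' hε₁ hLε (le_mantissa_mul hG hw hL0 _ _) ?_
        (wdist_triangle hG hw _ _ _) ?_ hr
      · refine (mantissa_mul_le hG hw hL0 hsp).trans ?_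
        rw [unitLength]
        gcongr
        exact pow_scale_mul_le hG hw hsp
      · have := wdist_triangle hG hw s t (pv t)
        rwa [wdist_comm hG hw t] at this
    rw [decodeDist]
    simp only [hst', if_false, g0, g1, g2, g3, g4, g5, g6]
    by_cases htS : t ∈ S
    · have hc : cls t = 0 := by simp [cls, htS]
      have hg : g (3, cls t, (s : ℕ)) = 0 := by rw [hc]; rfl
      rw [if_pos hg]
      refine hfar (by rwa [hpv_self t htS]) ?_
      rw [hpv_self t htS, wdist_self hw, mul_zero]
      linarith [wdist_pos hG hw hst]
    · have hc : cls t = idx (sig t) + 1 := by simp [cls, htS]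
      have hg : g (3, cls t, (s : ℕ)) = roundedDist (sig t) s := by
        rw [hc]
        simp only [g, tableEntry]
        rw [(hidx (sig t) (mem_image_of_mem _ (mem_sdiff.2 ⟨ht, htS⟩))).2]
        simp
      rw [hg]
      have hpt : pv t ≠ t := fun h => htS (h ▸ hpvS t)
      rcases roundedDist_signature hG hw hL0 hpt hs (hpv t s hs) with ⟨h0, h1, h2⟩ | ⟨h0, h1⟩
      · rw [if_neg h0]
        have e : minDist G w * (roundedDist (sig t) s * (2 ^ scale G w (pv t) t / L)) =
            roundedDist (sig t) s * unitLength G w L (pv t) t := by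
          rw [unitLength]; ring
        rw [e]
        refine ⟨h1, h2.trans ?_⟩
        have h3 := mul_unitLength (G := G) (w := w) hL0 (pv t) t
        have h4 := pow_scale_mul_le hG hw hpt
        have h5 := hpv t s hs
        have h6 := unitLength_pos hG hw hL0 (pv t) t
        have h7 : 8 * unitLength G w L (pv t) t ≤ ε * wdist G w s t := by
          calc 8 * unitLength G w L (pv t) t ≤ L * ε * unitLength G w L (pv t) t := by gcongr
            _ = ε * (L * unitLength G w L (pv t) t) := by ring
            _ ≤ ε * wdist G w s t := by
              rw [h3]; gcongr; exact h4.trans h5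
        linarith
      · rw [if_pos h0]
        have h2 := wdist_triangle hG hw s (pv t) t
        have h3 := lt_pow_scale_mul hG hw (pv t) t
        have h4 : L * (2 ^ scale G w (pv t) t * minDist G w) < wdist G w s (pv t) := by linarith
        refine hfar ?_ ?_
        · rintro h
          rw [← h, wdist_self hw] at h4
          have : 0 < L * (2 ^ scale G w s t * minDist G w) := by positivity
          rw [← h] at h3
          linarith
        · have := mul_le_mul_of_nonneg_left h3.le hL0'.le
          linarith
  · have hℓ : 1 ≤ 1 + Real.log n := by linarith
    have hΛ : 1 ≤ 1 + Real.log (aspectRatio G w) := by linarith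
    have hL1 : (1 : ℝ) ≤ L := by exact_mod_cast hL0
    have hS1 : (1 : ℝ) ≤ #S := by exact_mod_cast hS.card_pos
    refine le_trans ?_ (length_bound (m := #𝒞) hS1 hL1 hℓ hΛ (by positivity) ?_ ?_)
    · refine le_trans (Nat.cast_le.2 hlen) (sum_tableKeys_le S T _ _ ?_ ?_ ?_ ?_)
      all_goals
        set ℓ := 1 + Real.log n with hℓ_def
        set Λ := 1 + Real.log (aspectRatio G w) with hΛ_def
      · intro τ hτ t ht
        refine (entryCost_le (by omega) t.2.le (by omega)).trans ?_
        have hmul : ℓ ≤ ℓ * Λ ∧ Λ ≤ ℓ * Λ := ⟨by nlinarith, by nlinarith⟩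
        have hv : ((g (τ, (t : ℕ), 0)).size : ℝ) ≤ 2 * ℓ + 2 * Λ := by
          interval_cases τ
          · have : g (0, (t : ℕ), 0) ≤ n := (pv (Fin.ofNat n t)).2.le
            linarith [size_le_of_le hn this]
          · have h1 : ((g (1, (t : ℕ), 0)).size : ℝ) ≤ g (1, (t : ℕ), 0) := by
              exact_mod_cast size_le_self _
            have h2 : (g (1, (t : ℕ), 0) : ℝ) ≤ _ :=
              scale_le hG hw (pv (Fin.ofNat n t)) (Fin.ofNat n t)
            linarith
          · have : g (2, (t : ℕ), 0) ≤ n := by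
              simp only [g, tableEntry, Fin.ofNat_eq_cast, Fin.cast_val_eq_self]
              exact (hcls t ht).trans hm
            linarith [size_le_of_le hn this]
        linarith
      · intro c hc s hs
        refine (entryCost_le (by omega) (hc.trans hm) s.2.le).trans ?_
        have hv : g (3, c, (s : ℕ)) ≤ 3 * L ^ 2 := by
          cases c with
          | zero => exact Nat.zero_le _
          | succ c =>
            obtain ⟨t, -, ht⟩ := mem_image.1 (hinv c (by omega))
            simp only [g, tableEntry]
            rw [← ht]
            exact roundedDist_signature_le hG hw hL0 _ _ _
        have hv' : ((g (3, c, (s : ℕ))).size : ℝ) ≤ 3 * (L : ℝ) ^ 2 := by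
          exact_mod_cast (size_le_self _).trans hv
        have hL2 : (1 : ℝ) ≤ (L : ℝ) ^ 2 := one_le_pow₀ hL1
        nlinarith
      · intro τ hτ p hp s hs
        refine (entryCost_le (by omega) p.2.le s.2.le).trans ?_
        have hv : ((g (τ, (p : ℕ), (s : ℕ))).size : ℝ) ≤ 2 * L + 2 * Λ := by
          have h1 : ((g (τ, (p : ℕ), (s : ℕ))).size : ℝ) ≤ g (τ, (p : ℕ), (s : ℕ)) := by
            exact_mod_cast size_le_self _
          refine h1.trans ?_
          rcases hτ with rfl | rfl
          · have : g (4, (p : ℕ), (s : ℕ)) ≤ 2 * L :=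
              mantissa_le hG hw hL0 (Fin.ofNat n s) (Fin.ofNat n p)
            have : (g (4, (p : ℕ), (s : ℕ)) : ℝ) ≤ 2 * L := by exact_mod_cast this
            linarith
          · have h2 : (g (5, (p : ℕ), (s : ℕ)) : ℝ) ≤ _ :=
              scale_le hG hw (Fin.ofNat n s) (Fin.ofNat n p)
            linarith
        have hℓL : 1 ≤ ℓ * L := one_le_mul_of_one_le_of_one_le hℓ hL1
        have m1 : ℓ ≤ ℓ * L * Λ := by
          nlinarith [one_le_mul_of_one_le_of_one_le hL1 hΛ]
        have m2 : L ≤ ℓ * L * Λ := by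
          nlinarith [one_le_mul_of_one_le_of_one_le hℓ hΛ]
        have m3 : Λ ≤ ℓ * L * Λ := by nlinarith
        linarith
      · refine (entryCost_le (n := n) (by omega) (by omega) (by omega)).trans ?_
        have h1 : ((g (6, 0, 0)).size : ℝ) ≤ L := by exact_mod_cast size_le_self L
        have : ℓ ≤ ℓ * L := by nlinarith
        have : (L : ℝ) ≤ ℓ * L := by nlinarith
        linarith
    · let J := ⌊2 * Real.log (aspectRatio G w)⌋₊ + 1
      have hJ : ∀ u v, scale G w u v < J := fun u v =>
        Nat.lt_succ_iff.2 (Nat.le_floor (scale_le hG hw u v))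
      have hJ' : (J : ℝ) ≤ 2 * (1 + Real.log (aspectRatio G w)) := by
        have := Nat.floor_le (mul_nonneg zero_le_two hlogW)
        simp only [J]
        push_cast
        linarith
      have hcard : (#𝒞 : ℝ) ≤ #S * J * (2 * L + 1) *
          (1 + #S * (L ^ 2 + 1) + (#S * (L ^ 2 + 1)) ^ 2) := by
        exact_mod_cast card_image_signature_le R hG hR hw hface hL0 hpvS hJ (T \ S)
      have hN : (1 : ℝ) ≤ #S * L ^ 2 := one_le_mul_of_one_le_of_one_le hS1 (one_le_pow₀ hL1)
      have hN' : (#S : ℝ) * (L ^ 2 + 1) ≤ 2 * (#S * L ^ 2) := by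
        nlinarith [one_le_pow₀ (n := 2) hL1]
      calc (#𝒞 : ℝ) ≤ _ := hcard
        _ ≤ #S * (2 * (1 + Real.log (aspectRatio G w))) * (2 * L + L) *
            (12 * (#S * L ^ 2) ^ 2) := by
          gcongr
          have h1 : (#S : ℝ) * L ^ 2 ≤ (#S * L ^ 2) ^ 2 := le_self_pow₀ hN (by norm_num)
          have h2 : ((#S : ℝ) * (L ^ 2 + 1)) ^ 2 ≤ (2 * (#S * L ^ 2)) ^ 2 := by gcongr
          nlinarith
        _ = _ := by ring
    · rw [mul_div_assoc', mul_comm 9, mul_div_assoc]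
      gcongr

end Compression

end PlanarCompression

theorem mainTheorem7 :
    ∃ (dec : List Bool → ℕ → ℕ → ℝ) (C : ℝ) (k : ℕ),
      ∀ (n : ℕ) (G : SimpleGraph (Fin n)) (w : Sym2 (Fin n) → ℝ)
        (R : PlanarCompression.RotationSystem G) (S : Finset (Fin n)) (ε : ℝ),
        G.Connected → (∀ e ∈ G.edgeSet, 0 < w e) → R.IsPlanar → R.OnSingleFace S →
        0 < ε → ε ≤ 1 →
        (∃ b : List Bool,
          PlanarCompression.IsCompression dec G w S Finset.univ ε b ∧
          (b.length : ℝ) ≤ C * (((S.card : ℝ) / ε) ^ k + (n : ℝ)) *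
            (1 + Real.log (PlanarCompression.aspectRatio G w)) * (1 + Real.log n) ^ k) ∧
        (∀ T : Finset (Fin n), ∃ b : List Bool,
          PlanarCompression.IsCompression dec G w S T ε b ∧
          (b.length : ℝ) ≤ C * (((S.card : ℝ) / ε) ^ k + (T.card : ℝ)) *
            (1 + Real.log (PlanarCompression.aspectRatio G w)) * (1 + Real.log n) ^ k) := by
  refine ⟨PlanarCompression.decodeDist, 2000 * 9 ^ 7, 7, ?_⟩
  intro n G w R S ε hG hw hR hS hε hε₁
  suffices h : ∀ T : Finset (Fin n), ∃ b : List Bool,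
      PlanarCompression.IsCompression PlanarCompression.decodeDist G w S T ε b ∧
      (b.length : ℝ) ≤ 2000 * 9 ^ 7 * (((S.card : ℝ) / ε) ^ 7 + (T.card : ℝ)) *
        (1 + Real.log (PlanarCompression.aspectRatio G w)) * (1 + Real.log n) ^ 7 by
    refine ⟨?_, h⟩
    simpa using h Finset.univ
  intro T
  have hlogn : 0 ≤ Real.log n := Real.log_natCast_nonneg n
  rcases subsingleton_or_nontrivial (Fin n) with hn | hn
  · refine ⟨[], fun s _ t _ => ?_, ?_⟩
    · obtain rfl := Subsingleton.elim s t
      simp [PlanarCompression.decodeDist, PlanarCompression.wdist_self hw]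
    · have : PlanarCompression.distances G w = ∅ :=
        Set.eq_empty_of_forall_notMem fun x ⟨u, v, huv, _⟩ => huv (Subsingleton.elim u v)
      simp only [PlanarCompression.aspectRatio, PlanarCompression.minDist,
        PlanarCompression.maxDist, this, Real.sInf_empty, div_zero, Real.log_zero]
      simp only [List.length_nil, Nat.cast_zero]
      positivity
  · rcases S.eq_empty_or_nonempty with rfl | hne
    · refine ⟨[], fun s hs => absurd hs (Finset.notMem_empty s), ?_⟩
      have := Real.log_nonneg (PlanarCompression.one_le_aspectRatio hG hw)
      simp only [List.length_nil, Nat.cast_zero]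
      positivity
    · obtain ⟨v⟩ := hG.nonempty
      have : NeZero n := ⟨by have := v.2; omega⟩
      exact PlanarCompression.exists_compression R hG hw hR hS hε hε₁ hne T
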